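/- Let $G$ be a locally compact, second countable, unimodular (Hausdorff) group with Haar measure $dx$, let $K$ be a compact subgroup with normalized Haar measure $dk$, and let $\mu$ be the measure on $G/K$ with $\int_G f(x)\,dx=\int_{G/K}\int_K f(xk)\,dk\,d\mu(xK)$. Let $\mathcal{C}(G//K)$ be the space of continuous functions $f\colon G\to\mathbb{C}$ with $f(kxl)=f(x)$ for all $k,l\in K$, $x\in G$, with the topology of uniform convergence on compact sets. Let $\mathcal{M}_c(G//K)$ be the convolution algebra of compactly supported complex Borel measures $\nu$ on $G$ with $\int f\,d\nu=\int_G\int_K\int_K f(lxk)\,dl\,dk\,d\nu(x)$ for all continuous $f$. The pair $(G,K)$ is a Gelfand pair if $\mathcal{M}_c(G//K)$ is commutative. A function $f\in\mathcal{C}(G//K)$ is $K$-spherical if $f(e)=1$ (equivalently, $f\neq 0$) and $\int_K f(xky)\,dk=f(x)f(y)$ for all $x,y\in G$; let $\mathcal{S}$ be the set of these functions. A $K$-variety is a closed linear subspace of $\mathcal{C}(G//K)$ that contains, with each $f$ and for each $g\in G$, the function $x\mapsto\int_K f(xkg)\,dk$. The group $G$ satisfies $K$-spectral analysis if every nonzero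 $K$-variety contains an element of $\mathcal{S}$. For $f\in\mathcal{S}$ and $\nu\in\mathcal{M}_c(G//K)$ put $\Phi_f(\nu)=\int_G f(x^{-1})\,d\nu(x)$, and for an ideal $I$ of $\mathcal{M}_c(G//K)$ put $Z(I)=\{f\in\mathcal{S} : \Phi_f(\nu)=0 \text{ for all } \nu\in I\}$. A compact set $E\subseteq G/K$ has the Pompeiu property if $f=0$ is the only continuous function $f\colon G/K\to\mathbb{C}$ with $\int_{gE}f\,d\mu=0$ for all $g\in G$. Write $\widetilde{E}=\{g\in G : gK\in E\}$; let $\check{\chi}_{\widetilde{E}}$ be the measure $\chi_{\widetilde{E}}(x^{-1})\,dx$, and for $g\in G$ let $\chi_{\widetilde{gK}}$ be the probability measure $f\mapsto\int_K f(gk)\,dk$ carried by the coset $gK$. **Theorem.** Suppose that $(G,K)$ is a Gelfand pair and that $G$ satisfies $K$-spectral analysis. Let $E$ be a compact subset of $G/K$, let $T$ be a left transversal of $K$ in $G$ (a set of representatives of the left cosets $gK$), and let $I$ be the ideal of $\mathcal{M}_c(G//K)$ generated by $\{\check{\chi}_{\widetilde{E}}*\chi_{\widetilde{gK}} : g\in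 T\}$. Then $E$ has the Pompeiu property if and only if $Z(I)=\emptyset$. -/

import Mathlib

open MeasureTheory Set Topology
open scoped Pointwise

namespace Pompeiu

variable {G : Type*} [TopologicalSpace G] [Group G] [IsTopologicalGroup G]
  [MeasurableSpace G] [BorelSpace G]

/-! ### Integration over the compact subgroup and over the homogeneous space -/

/-- The Haar measure `dk` of the compact group `K`, normalized to total mass one. -/
noncomputable def normHaar (K : Subgroup G) [CompactSpace K] : Measure K :=
  Measure.haarMeasure ⊤

instance (K : Subgroup G) [CompactSpace K] : IsProbabilityMeasure (normHaar K) where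
  measure_univ := Measure.haarMeasure_self

/-- The measure on `G ⧸ K` induced by the Haar measure `dx` of the unimodular group `G`: the image
of `dx` under the canonical projection. As `dk` has mass one, this is the measure for which
`∫_G f(x) dx = ∫_{G/K} ∫_K f(xk) dk d(xK)`; see `integral_quotientMeasure`. -/
noncomputable def quotientMeasure (dx : Measure G) (K : Subgroup G) : Measure (G ⧸ K) :=
  dx.map (fun x : G => (x : G ⧸ K))

/-- A set `E` has the Pompeiu property if the zero function is the only continuous function
on `G ⧸ K` whose integral over every translate `gE` vanishes. -/
def HasPompeiuProperty (dx : Measure G) (K : Subgroup G) (E : Set (G ⧸ K)) : Prop :=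
  ∀ f : C(G ⧸ K, ℂ), (∀ g : G, ∫ x in g • E, f x ∂(quotientMeasure dx K) = 0) → f = 0

/-- The lift of `E ⊆ G ⧸ K` to `G`, that is `{g | gK ∈ E}`. -/
def lift (K : Subgroup G) (E : Set (G ⧸ K)) : Set G := {g : G | (g : G ⧸ K) ∈ E}

/-! ### Biinvariant functions -/

theorem continuous_integral_normHaar (K : Subgroup G) [CompactSpace K] {X : Type*}
    [TopologicalSpace X] [FirstCountableTopology X] [LocallyCompactSpace X]
    {F : X → K → ℂ} (hF : Continuous F.uncurry) :
    Continuous fun x => ∫ k, F x k ∂(normHaar K) := by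
  have h := continuous_parametric_integral_of_continuous (μ := normHaar K) hF
    (isCompact_univ (X := K))
  simpa using h

variable [LocallyCompactSpace G] [T2Space G] [SecondCountableTopology G]

/-- The space `C(G//K)` of continuous `K`-biinvariant functions. -/
def biinvFunctions (K : Subgroup G) : Submodule ℂ C(G, ℂ) where
  carrier := {f | ∀ k ∈ K, ∀ l ∈ K, ∀ x : G, f (k * x * l) = f x}
  add_mem' hf hg := fun k hk l hl x => by
    simp [hf k hk l hl x, hg k hk l hl x]
  zero_mem' := fun _ _ _ _ _ => rfl
  smul_mem' c f hf := fun k hk l hl x => by simp [hf k hk l hl x]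

/-- The biinvariant projection `f^#(x) = ∫_K ∫_K f(lxk) dl dk`. -/
noncomputable def proj (K : Subgroup G) [CompactSpace K] (f : C(G, ℂ)) : C(G, ℂ) where
  toFun x := ∫ k : K, ∫ l : K, f ((l : G) * x * (k : G)) ∂(normHaar K) ∂(normHaar K)
  continuous_toFun := by
    have : SecondCountableTopology K := TopologicalSpace.Subtype.secondCountableTopology (K : Set G)
    refine continuous_integral_normHaar K
      (F := fun (x : G) (k : K) => ∫ l : K, f ((l : G) * x * (k : G)) ∂(normHaar K)) ?_
    refine continuous_integral_normHaar K
      (F := fun (p : G × K) (l : K) => f ((l : G) * p.1 * (p.2 : G))) ?_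
    simp only [Function.uncurry_def]
    fun_prop

/-- The right `K`-translate of `f` by `g`, namely `τ_g f (x) = ∫_K f(xkg) dk`. -/
noncomputable def translate (K : Subgroup G) [CompactSpace K] (g : G) (f : C(G, ℂ)) :
    C(G, ℂ) where
  toFun x := ∫ k : K, f (x * (k : G) * g) ∂(normHaar K)
  continuous_toFun := by
    refine continuous_integral_normHaar K
      (F := fun (x : G) (k : K) => f (x * (k : G) * g)) ?_
    simp only [Function.uncurry_def]
    fun_prop

/-- A `K`-variety: a closed, `K`-translation invariant linear subspace of `C(G//K)`, where `C(G, ℂ)`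
carries the topology of uniform convergence on compact sets (in which `C(G//K)` is closed). -/
structure IsVariety (K : Subgroup G) [CompactSpace K] (V : Submodule ℂ C(G, ℂ)) : Prop where
  le_biinv : V ≤ biinvFunctions K
  isClosed : IsClosed (V : Set C(G, ℂ))
  translate_mem : ∀ f ∈ V, ∀ g : G, translate K g f ∈ V

/-- The set of (continuous, nonzero) `K`-spherical functions. -/
def sphericalFunctions (K : Subgroup G) [CompactSpace K] : Set C(G, ℂ) :=
  {f | f ∈ biinvFunctions K ∧ f 1 = 1 ∧
    ∀ x y : G, ∫ k : K, f (x * (k : G) * y) ∂(normHaar K) = f x * f y}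

/-- `K`-spectral analysis holds on `V` if every nonzero `K`-variety contained in `V` contains a
`K`-spherical function. -/
def SpectralAnalysisOn (K : Subgroup G) [CompactSpace K] (V : Submodule ℂ C(G, ℂ)) : Prop :=
  ∀ W : Submodule ℂ C(G, ℂ), IsVariety K W → W ≤ V → W ≠ ⊥ → ∃ f ∈ W, f ∈ sphericalFunctions K

/-- `K`-spectral analysis holds on `G`. -/
def SpectralAnalysis (K : Subgroup G) [CompactSpace K] : Prop :=
  SpectralAnalysisOn K (biinvFunctions K)

/-! ### Compactly supported complex measures -/

/-- The pairing `⟨f, μ⟩ = ∫ f dμ` of a function and a complex measure. -/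
noncomputable def pairing (f : G → ℂ) (μ : ComplexMeasure G) : ℂ :=
  VectorMeasure.integral μ f (ContinuousLinearMap.mul ℝ ℂ)

/-- The reflected measure, the image of `μ` under inversion; `⟨f, μ̌⟩ = ∫ f(x⁻¹) dμ(x)`. -/
noncomputable def reflect (μ : ComplexMeasure G) : ComplexMeasure G :=
  VectorMeasure.map μ (fun x : G => x⁻¹)

/-- Complex measures have finite total variation. In particular their products exist. -/
instance {X : Type*} [MeasurableSpace X] (μ : ComplexMeasure X) :
    IsFiniteMeasure (VectorMeasure.variation μ) := by
  have key : VectorMeasure.variation μ ≤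
      (ComplexMeasure.re μ).totalVariation + (ComplexMeasure.im μ).totalVariation := by
    rw [SignedMeasure.totalVariation_eq_variation, SignedMeasure.totalVariation_eq_variation]
    refine VectorMeasure.variation_le_of_forall_enorm_le fun s hs => ?_
    have h1 : ‖μ s‖ₑ ≤ ‖ComplexMeasure.re μ s‖ₑ + ‖ComplexMeasure.im μ s‖ₑ := by
      have h2 : ‖μ s‖₊ ≤ ‖(μ s).re‖₊ + ‖(μ s).im‖₊ := by
        have := Complex.norm_le_abs_re_add_abs_im (μ s)
        exact_mod_cast this
      have h3 : ComplexMeasure.re μ s = (μ s).re := rfl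
      have h4 : ComplexMeasure.im μ s = (μ s).im := rfl
      rw [h3, h4]
      simp only [enorm_eq_nnnorm]
      exact_mod_cast h2
    rw [Measure.add_apply]
    exact h1.trans (add_le_add (VectorMeasure.enorm_measure_le_variation _ _)
      (VectorMeasure.enorm_measure_le_variation _ _))
  have : IsFiniteMeasure
      ((ComplexMeasure.re μ).totalVariation + (ComplexMeasure.im μ).totalVariation) := by
    unfold SignedMeasure.totalVariation
    infer_instance
  exact isFiniteMeasure_of_le _ key

/-- The convolution `μ * ν`: the image of the product measure under the multiplication of `G`, so
that `⟨f, μ * ν⟩ = ∫ f(xy) dμ(x) dν(y)`. -/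
noncomputable def conv (μ ν : ComplexMeasure G) : ComplexMeasure G :=
  VectorMeasure.map (VectorMeasure.prod μ ν (ContinuousLinearMap.mul ℝ ℂ))
    (fun p : G × G => p.1 * p.2)

/-- `μ` has compact support: it vanishes off some compact set. -/
def HasCompactSupp (μ : ComplexMeasure G) : Prop :=
  ∃ C : Set G, IsCompact C ∧ ∀ A : Set G, MeasurableSet A → Disjoint A C → μ A = 0

/-- The space `M_c(G//K)` of compactly supported `K`-biinvariant complex Borel measures. -/
def biinvMeasures (K : Subgroup G) [CompactSpace K] : Set (ComplexMeasure G) :=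
  {μ | HasCompactSupp μ ∧ ∀ f : C(G, ℂ), pairing f μ = pairing (proj K f) μ}

/-- `(G, K)` is a Gelfand pair: the convolution algebra `M_c(G//K)` is commutative. -/
def IsGelfandPair (K : Subgroup G) [CompactSpace K] : Prop :=
  ∀ μ ∈ biinvMeasures K, ∀ ν ∈ biinvMeasures K, conv μ ν = conv ν μ

/-- The two-sided ideals of the algebra `M_c(G//K)`. -/
structure IsIdeal (K : Subgroup G) [CompactSpace K] (I : Submodule ℂ (ComplexMeasure G)) :
    Prop where
  subset_biinv : (I : Set (ComplexMeasure G)) ⊆ biinvMeasures K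
  conv_mem_right : ∀ μ ∈ I, ∀ ν ∈ biinvMeasures K, conv μ ν ∈ I
  conv_mem_left : ∀ μ ∈ I, ∀ ν ∈ biinvMeasures K, conv ν μ ∈ I

/-- The ideal of `M_c(G//K)` generated by `S`: the smallest one containing `S`. -/
noncomputable def idealSpan (K : Subgroup G) [CompactSpace K] (S : Set (ComplexMeasure G)) :
    Submodule ℂ (ComplexMeasure G) :=
  sInf {J | IsIdeal K J ∧ S ⊆ (J : Set (ComplexMeasure G))}

/-- The transform `Φ_f(μ) = ⟨f, μ̌⟩`. -/
noncomputable def transform (f : C(G, ℂ)) (μ : ComplexMeasure G) : ℂ :=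
  pairing f (reflect μ)

/-- The zero set `Z(I)`: the spherical functions `f` with `Φ_f(μ) = 0` for all `μ ∈ I`. -/
def zeroSet (K : Subgroup G) [CompactSpace K] (I : Submodule ℂ (ComplexMeasure G)) :
    Set C(G, ℂ) :=
  {f | f ∈ sphericalFunctions K ∧ ∀ μ ∈ I, transform f μ = 0}

/-! ### The generators attached to a compact subset of the homogeneous space -/

/-- The measure with density `x ↦ χ_A(x⁻¹)`, for the characteristic function `χ_A` of `A ⊆ G`. -/
noncomputable def reflectedIndicator (dx : Measure G) (A : Set G) : ComplexMeasure G :=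
  dx.withDensityᵥ (fun x : G => A.indicator (fun _ => (1 : ℂ)) x⁻¹)

/-- The coset `gK`, regarded as the compactly supported measure `f ↦ ∫_K f(gk) dk`. -/
noncomputable def cosetMeasure (K : Subgroup G) [CompactSpace K] (g : G) : ComplexMeasure G :=
  VectorMeasure.map ((normHaar K).withDensityᵥ (fun _ : K => (1 : ℂ))) (fun k : K => g * (k : G))

/-- The ideal of `M_c(G//K)` generated by the convolutions of the reflected indicator of the lift
of `E` with the cosets `gK`, for `g ∈ T`. -/
noncomputable def pompeiuIdeal (dx : Measure G) (K : Subgroup G) [CompactSpace K]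
    (E : Set (G ⧸ K)) (T : Set G) : Submodule ℂ (ComplexMeasure G) :=
  idealSpan K {μ | ∃ g ∈ T, μ = conv (reflectedIndicator dx (lift K E)) (cosetMeasure K g)}

/-- The defining formula of the measure on the homogeneous space. -/
theorem integral_quotientMeasure (dx : Measure G) [dx.IsHaarMeasure] [dx.IsMulRightInvariant]
    (K : Subgroup G) [CompactSpace K] (f : C(G, ℂ)) (hf : HasCompactSupport f)
    (F : G ⧸ K → ℂ) (hF : ∀ x : G, F (x : G ⧸ K) = ∫ k : K, f (x * (k : G)) ∂(normHaar K)) :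
    ∫ x, f x ∂dx = ∫ p, F p ∂(quotientMeasure dx K) := by
  have hc : Continuous (Function.uncurry fun (x : G) (k : K) => f (x * (k : G))) := by
    simp only [Function.uncurry_def]
    fun_prop
  have hs : HasCompactSupport (Function.uncurry fun (x : G) (k : K) => f (x * (k : G))) := by
    refine HasCompactSupport.intro
      (K := (fun p : G × K => (p.1 * (p.2 : G)⁻¹, p.2)) '' (tsupport f ×ˢ univ)) ?_ ?_
    · refine (IsCompact.prod hf isCompact_univ).image ?_
      fun_prop
    · rintro ⟨x, k⟩ hxk
      by_contra hne
      refine hxk ⟨(x * (k : G), k), ⟨subset_tsupport _ hne, mem_univ _⟩, ?_⟩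
      simp
  have hmk : Measurable (fun x : G => (x : G ⧸ K)) := measurable_quotient_mk''
  have hFm : Measurable F := by
    refine measurable_from_quotient.2 ?_
    have h := (continuous_integral_normHaar K hc).measurable
    have h2 : (F ∘ Quotient.mk'' : G → ℂ) = fun x => ∫ k : K, f (x * (k : G)) ∂(normHaar K) :=
      funext hF
    rw [h2]
    exact h
  have : IsFiniteMeasureOnCompacts (normHaar K) := inferInstance
  rw [quotientMeasure, integral_map hmk.aemeasurable hFm.aestronglyMeasurable]
  simp_rw [hF]
  rw [integral_integral_swap_of_hasCompactSupport hc hs]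
  simp [integral_mul_right_eq_self (μ := dx)]

end Pompeiu

/-!
Write `A ⊆ G` for the lift of `E`. Both sides of the equivalence concern the space `V` of continuous
biinvariant functions whose integral over every left translate `gA` vanishes
(`vanishingIntegrals`).

The transform of the generator `χ̌_A * χ_{gK}` at a biinvariant function `f` is the integral of `f`
over `g⁻¹A` (`transform_generator`, where unimodularity enters as inversion invariance of `dx`). For
a spherical function `s` the transform `Φ_s` is multiplicative on the biinvariant measures
(`transform_conv`), so its kernel is an ideal. Since every `g` is a product `t k` with `t ∈ T`,
`k ∈ K`, the zero set of the ideal is therefore exactly the set of spherical functions in `V`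
(`mem_zeroSet_pompeiuIdeal_iff`).

A spherical function in `V` descends to a nonzero function on `G ⧸ K` violating the Pompeiu
property. Conversely, from a function violating the Pompeiu property, translation and left averaging
over `K` produce a nonzero element of `V` (`exists_mem_vanishingIntegrals`). The space `V` is a
variety (`isVariety_vanishingIntegrals`): for a measure `m` on `G` and `y ∈ G`, commutativity of the
convolution applied to the biinvariant averages of `m` and of the point mass at `y` gives
`∫∫ f(x k y) dk dm(x) = ∫∫ f(y k x) dm(x) dk` for biinvariant `f`
(`IsGelfandPair.integral_mconv_comm`). With `m` the restriction of `dx` to `gA` and `f ∈ V` the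
right side is an average of integrals over the translates `ykgA`, so it vanishes. Spectral analysis now
provides a spherical function in `V`.

For the calculus of complex measures, a compactly supported complex measure is written as `h dm`
with `m` its variation and `h` integrable (`HasCompactSupp.exists_eq_withDensityᵥ`), which reduces
its pairings and convolutions to Bochner integrals and Fubini's theorem. The measures that occur
explicitly are positive, and are handled through the convolution `∗ₘ` of positive measures.
-/

set_option linter.unusedSectionVars false

namespace Pompeiu

/-! ### Invariance of Haar measures -/

section Haar

variable {H : Type*} [TopologicalSpace H] [Group H] [IsTopologicalGroup H]
  [MeasurableSpace H] [BorelSpace H]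

theorem isInvInvariant_of_isMulRightInvariant [LocallyCompactSpace H] (μ : Measure H)
    [μ.IsHaarMeasure] [μ.IsMulRightInvariant] [μ.Regular] : μ.IsInvInvariant := by
  -- By uniqueness of Haar measure `μ.inv = c • μ`; inverting twice gives `c ^ 2 = 1`.
  constructor
  let c : ENNReal := Measure.haarScalarFactor μ.inv μ
  have hc : μ.inv = c • μ := Measure.isMulLeftInvariant_eq_smul_of_regular μ.inv μ
  have h2 : Measure.map Inv.inv (Measure.map Inv.inv μ) = c ^ 2 • μ := by
    rw [← Measure.inv_def μ, hc, Measure.map_smul, ← Measure.inv_def μ, hc, smul_smul, pow_two]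
  have μeq : μ = c ^ 2 • μ := by
    rw [Measure.map_map continuous_inv.measurable continuous_inv.measurable] at h2
    simpa only [inv_involutive, Function.Involutive.comp_self, Measure.map_id] using h2
  have C : TopologicalSpace.PositiveCompacts H := Classical.arbitrary _
  have h3 : c ^ 2 * μ C = 1 ^ 2 * μ C := by
    conv_rhs => rw [μeq]
    simp
  have h4 : c ^ 2 = 1 ^ 2 :=
    (ENNReal.mul_left_inj (Measure.measure_pos_of_nonempty_interior _ C.interior_nonempty).ne'
      C.isCompact.measure_lt_top.ne).1 h3
  have h5 : c = 1 := (ENNReal.pow_right_strictMono two_ne_zero).injective h4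
  rw [hc, h5, one_smul]

/-- Right translates of a Haar probability measure are Haar probability measures, hence equal to it
by uniqueness. -/
theorem isMulRightInvariant_of_isProbabilityMeasure [LocallyCompactSpace H] (μ : Measure H)
    [μ.IsHaarMeasure] [IsProbabilityMeasure μ] : μ.IsMulRightInvariant := by
  constructor
  intro g
  have : IsProbabilityMeasure (Measure.map (· * g) μ) :=
    Measure.isProbabilityMeasure_map (measurable_mul_const g).aemeasurable
  exact Measure.isHaarMeasure_eq_of_isProbabilityMeasure _ _

end Haar

variable {G : Type*} [TopologicalSpace G] [Group G] [IsTopologicalGroup G]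
  [MeasurableSpace G] [BorelSpace G]

instance (K : Subgroup G) [CompactSpace K] : (normHaar K).IsHaarMeasure :=
  inferInstanceAs (Measure.haarMeasure ⊤).IsHaarMeasure

instance (K : Subgroup G) [CompactSpace K] : (normHaar K).IsMulRightInvariant :=
  isMulRightInvariant_of_isProbabilityMeasure _

instance (K : Subgroup G) [CompactSpace K] [SecondCountableTopology G] [T2Space G] :
    (normHaar K).IsInvInvariant := by
  have : SecondCountableTopology K := TopologicalSpace.Subtype.secondCountableTopology (K : Set G)
  exact isInvInvariant_of_isMulRightInvariant _

/-! ### Integration against complex measures with a density -/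

section Density

variable {X : Type*} [MeasurableSpace X]

theorem Integrable.mul_of_withDensity_enorm {m : Measure X} {f h : X → ℂ} (hh : Integrable h m)
    (hf : Integrable f (m.withDensity fun x => ‖h x‖ₑ)) : Integrable (fun x => f x * h x) m := by
  have h1 : AEMeasurable (fun x => ‖h x‖₊) m := hh.aestronglyMeasurable.nnnorm.aemeasurable
  have h2 := (integrable_withDensity_iff_integrable_smul₀ (μ := m) (g := f) h1).1 hf
  -- `f` need not be measurable where `h` vanishes, so `f * h` is written as
  -- `(‖h‖ • f) * (h / ‖h‖)`.
  have h3 : (fun x => f x * h x) = fun x => (‖h x‖₊ • f x) * (h x / (‖h x‖ : ℂ)) := by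
    funext x
    by_cases hx : h x = 0
    · simp [hx]
    · have : (‖h x‖ : ℂ) ≠ 0 := by simpa using hx
      rw [NNReal.smul_def, coe_nnnorm, Complex.real_smul]
      field_simp
  refine h2.mono ?_ (Filter.Eventually.of_forall fun x => ?_)
  · rw [h3]
    have h4 : AEStronglyMeasurable (fun x => (‖h x‖ : ℂ)) m :=
      (Complex.measurable_ofReal.comp_aemeasurable
        hh.aestronglyMeasurable.norm.aemeasurable).aestronglyMeasurable
    exact h2.aestronglyMeasurable.mul
      (hh.aestronglyMeasurable.aemeasurable.div h4.aemeasurable).aestronglyMeasurable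
  · rw [norm_mul, NNReal.smul_def, norm_smul, coe_nnnorm, norm_norm, mul_comm]

/-- Integration against the complex measure `h dm` is integration of the product with `h`. -/
theorem integral_withDensityᵥ {m : Measure X} {f h : X → ℂ} (hh : Integrable h m)
    (hf : Integrable f (m.withDensity fun x => ‖h x‖ₑ)) :
    VectorMeasure.integral (m.withDensityᵥ h) f (ContinuousLinearMap.mul ℝ ℂ)
      = ∫ x, f x * h x ∂m := by
  have hv := Measure.variation_withDensityᵥ hh
  have hh' : AEMeasurable (fun x => ‖h x‖ₑ) m := hh.aestronglyMeasurable.enorm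
  rw [← hv] at hf
  refine Integrable.induction (P := fun f => VectorMeasure.integral (m.withDensityᵥ h) f
    (ContinuousLinearMap.mul ℝ ℂ) = ∫ x, f x * h x ∂m) ?_ ?_ ?_ ?_ hf
  · intro c s hs _
    have h1 : (fun x => s.indicator (fun _ => c) x * h x) = s.indicator fun x => c * h x := by
      funext x
      by_cases hx : x ∈ s <;> simp [hx]
    rw [h1, integral_indicator hs, VectorMeasure.integral_indicator_const, integral_const_mul,
      withDensityᵥ_apply hh hs]
    · rfl
    · exact hs
  · intro f g _ hf hg hfe hge
    rw [VectorMeasure.integral_add hf hg, hfe, hge]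
    rw [hv] at hf hg
    simp only [Pi.add_apply, add_mul]
    rw [integral_add (Integrable.mul_of_withDensity_enorm hh hf)
      (Integrable.mul_of_withDensity_enorm hh hg)]
  · refine isClosed_eq VectorMeasure.continuous_integral ?_
    refine LipschitzWith.continuous (K := 1) fun f g => ?_
    have hv1 : ∀ u : X → ℂ, Integrable u (m.withDensityᵥ h).variation →
        Integrable u (m.withDensity fun x => ‖h x‖ₑ) := fun u hu => by rwa [hv] at hu
    have hv2 : ∀ u : X → ENNReal, ∫⁻ x, u x ∂(m.withDensityᵥ h).variation =
        ∫⁻ x, u x ∂(m.withDensity fun x => ‖h x‖ₑ) := fun u => by rw [hv]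
    have hf := hv1 _ (L1.integrable_coeFn f)
    have hg := hv1 _ (L1.integrable_coeFn g)
    rw [ENNReal.coe_one, one_mul, edist_eq_enorm_sub,
      ← integral_sub (Integrable.mul_of_withDensity_enorm hh hf)
      (Integrable.mul_of_withDensity_enorm hh hg)]
    refine (enorm_integral_le_lintegral_enorm _).trans (le_of_eq ?_)
    rw [Lp.edist_def, eLpNorm_one_eq_lintegral_enorm, hv2,
      lintegral_withDensity_eq_lintegral_mul₀' hh' (hf.sub hg).aestronglyMeasurable.enorm]
    refine lintegral_congr fun x => ?_
    rw [← sub_mul, enorm_mul, mul_comm]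
    rfl
  · intro f g hfg _ hfe
    rw [← VectorMeasure.integral_congr_ae hfg, hfe]
    refine integral_congr_ae ?_
    rw [Filter.EventuallyEq, hv, ae_withDensity_iff' hh'] at hfg
    filter_upwards [hfg] with x hx
    by_cases h0 : h x = 0
    · simp [h0]
    · rw [hx (by simpa using h0)]

/-- Every complex measure has an integrable density with respect to its variation. -/
theorem exists_integrable_withDensityᵥ_variation_eq (μ : ComplexMeasure X)
    [IsFiniteMeasure (VectorMeasure.variation μ)] :
    ∃ h : X → ℂ, Integrable h (VectorMeasure.variation μ) ∧
      μ = (VectorMeasure.variation μ).withDensityᵥ h := by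
  set m := VectorMeasure.variation μ with hm
  have hac : ∀ s, MeasurableSet s → m s = 0 → μ s = 0 := fun s hs h0 => by
    have := VectorMeasure.enorm_measure_le_variation μ s
    rw [← hm, h0] at this
    simpa using this
  have hre : ComplexMeasure.re μ ≪ᵥ m.toENNRealVectorMeasure :=
    VectorMeasure.AbsolutelyContinuous.mk fun s hs h0 => by
      rw [Measure.toENNRealVectorMeasure_apply_measurable hs] at h0
      exact congrArg Complex.re (hac s hs h0)
  have him : ComplexMeasure.im μ ≪ᵥ m.toENNRealVectorMeasure :=
    VectorMeasure.AbsolutelyContinuous.mk fun s hs h0 => by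
      rw [Measure.toENNRealVectorMeasure_apply_measurable hs] at h0
      exact congrArg Complex.im (hac s hs h0)
  have h1 := SignedMeasure.withDensityᵥ_rnDeriv_eq _ _ hre
  have h2 := SignedMeasure.withDensityᵥ_rnDeriv_eq _ _ him
  have i1 := SignedMeasure.integrable_rnDeriv (ComplexMeasure.re μ) m
  have i2 := SignedMeasure.integrable_rnDeriv (ComplexMeasure.im μ) m
  set a := (ComplexMeasure.re μ).rnDeriv m
  set b := (ComplexMeasure.im μ).rnDeriv m
  have i3 : Integrable (fun x => (a x : ℂ) + (b x : ℂ) * Complex.I) m :=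
    i1.ofReal.add (i2.ofReal.mul_const _)
  refine ⟨_, i3, ?_⟩
  ext s hs
  have e1 : ∫ x in s, (a x : ℂ) ∂m = ((∫ x in s, a x ∂m : ℝ) : ℂ) := integral_ofReal
  have e2 : ∫ x in s, (b x : ℂ) ∂m = ((∫ x in s, b x ∂m : ℝ) : ℂ) := integral_ofReal
  have i1' : Integrable (fun x => (a x : ℂ)) (m.restrict s) := i1.ofReal.restrict
  have i2' : Integrable (fun x => (b x : ℂ) * Complex.I) (m.restrict s) :=
    (i2.ofReal.mul_const _).restrict
  rw [withDensityᵥ_apply i3 hs, integral_add i1' i2', integral_mul_const, e1, e2,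
    ← withDensityᵥ_apply i1 hs, ← withDensityᵥ_apply i2 hs, h1, h2]
  exact (Complex.re_add_im _).symm

/-- The product of complex measures with densities `h` and `k` has the density `h(x) k(y)`. -/
theorem prod_withDensityᵥ {Y : Type*} [MeasurableSpace Y] {m : Measure X} {n : Measure Y}
    [SFinite m] [SFinite n] {h : X → ℂ} {k : Y → ℂ} (hh : Integrable h m) (hk : Integrable k n) :
    VectorMeasure.prod (m.withDensityᵥ h) (n.withDensityᵥ k) (ContinuousLinearMap.mul ℝ ℂ)
      = (m.prod n).withDensityᵥ fun p => h p.1 * k p.2 := by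
  refine VectorMeasure.prod_eq_of_forall_apply_prod fun s t hs ht => ?_
  rw [withDensityᵥ_apply (hh.mul_prod hk) (hs.prod ht), withDensityᵥ_apply hh hs,
    withDensityᵥ_apply hk ht, setIntegral_prod_mul]
  rfl

end Density

/-! ### Measures carried by a compact set -/

section Carried

variable {X Y : Type*} [TopologicalSpace X] [MeasurableSpace X]
  [TopologicalSpace Y] [MeasurableSpace Y]

/-- A measure is compactly carried if the complement of some compact set is a null set. -/
def IsCompactlyCarried (m : Measure X) : Prop :=
  ∃ C : Set X, IsCompact C ∧ m Cᶜ = 0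

theorem isCompactlyCarried_of_compactSpace [CompactSpace X] (m : Measure X) :
    IsCompactlyCarried m :=
  ⟨univ, isCompact_univ, by simp⟩

theorem isCompactlyCarried_restrict [T2Space X] [OpensMeasurableSpace X] (m : Measure X)
    {C : Set X} (hC : IsCompact C) : IsCompactlyCarried (m.restrict C) :=
  ⟨C, hC, by rw [Measure.restrict_apply hC.measurableSet.compl]; simp⟩

theorem IsCompactlyCarried.prod {m : Measure X} {n : Measure Y} [SFinite m] [SFinite n]
    (hm : IsCompactlyCarried m) (hn : IsCompactlyCarried n) : IsCompactlyCarried (m.prod n) := by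
  obtain ⟨C, hC, hmC⟩ := hm
  obtain ⟨D, hD, hnD⟩ := hn
  refine ⟨C ×ˢ D, hC.prod hD, measure_mono_null (t := Cᶜ ×ˢ univ ∪ univ ×ˢ Dᶜ) ?_ ?_⟩
  · rintro ⟨x, y⟩ hxy
    by_contra h
    simp_all
  · simp [Measure.prod_prod, hmC, hnD]

theorem IsCompactlyCarried.map {m : Measure X} (hm : IsCompactlyCarried m) [OpensMeasurableSpace X]
    [BorelSpace Y] [T2Space Y] {φ : X → Y} (hφ : Continuous φ) :
    IsCompactlyCarried (m.map φ) := by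
  obtain ⟨C, hC, hmC⟩ := hm
  refine ⟨φ '' C, hC.image hφ, ?_⟩
  rw [Measure.map_apply hφ.measurable (hC.image hφ).measurableSet.compl]
  exact measure_mono_null (fun x hx hxC => hx ⟨x, hxC, rfl⟩) hmC

theorem Continuous.integrable_mul [OpensMeasurableSpace X] {m : Measure X}
    (hm : IsCompactlyCarried m) {F h : X → ℂ} (hF : Continuous F) (hh : Integrable h m) :
    Integrable (fun x => F x * h x) m := by
  obtain ⟨C, hC, hmC⟩ := hm
  obtain ⟨c, hc⟩ := hC.exists_bound_of_continuousOn hF.continuousOn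
  refine hh.bdd_mul (c := c) hF.measurable.aestronglyMeasurable ?_
  have : ∀ᵐ x ∂m, x ∈ C := hmC
  filter_upwards [this] with x hx using hc x hx

theorem Continuous.integrable_of_isCompactlyCarried [OpensMeasurableSpace X] {m : Measure X}
    [IsFiniteMeasure m] (hm : IsCompactlyCarried m) {F : X → ℂ} (hF : Continuous F) :
    Integrable F m := by
  simpa using Continuous.integrable_mul hm hF (integrable_const (1 : ℂ))

/-- Continuous functions are integrable against `h dm`, as they are bounded on the compact set that
carries `m`. -/
theorem integral_mul_withDensityᵥ [OpensMeasurableSpace X] {m : Measure X}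
    (hm : IsCompactlyCarried m) {F h : X → ℂ} (hF : Continuous F) (hh : Integrable h m) :
    Integrable F (m.withDensityᵥ h).variation ∧
    VectorMeasure.integral (m.withDensityᵥ h) F (ContinuousLinearMap.mul ℝ ℂ)
      = ∫ x, F x * h x ∂m := by
  have : IsFiniteMeasure (m.withDensity fun x => ‖h x‖ₑ) :=
    isFiniteMeasure_withDensity hh.2.ne
  have hc : IsCompactlyCarried (m.withDensity fun x => ‖h x‖ₑ) := by
    obtain ⟨C, hC, hmC⟩ := hm
    exact ⟨C, hC, withDensity_absolutelyContinuous _ _ hmC⟩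
  have hF' := Continuous.integrable_of_isCompactlyCarried hc hF
  refine ⟨?_, integral_withDensityᵥ hh hF'⟩
  rwa [Measure.variation_withDensityᵥ hh]

end Carried

/-! ### Compactly supported complex measures -/

theorem pairing_withDensityᵥ {m : Measure G} (hm : IsCompactlyCarried m) {f h : G → ℂ}
    (hf : Continuous f) (hh : Integrable h m) :
    pairing f (m.withDensityᵥ h) = ∫ x, f x * h x ∂m :=
  (integral_mul_withDensityᵥ hm hf hh).2

variable [LocallyCompactSpace G] [T2Space G] [SecondCountableTopology G]

theorem hasCompactSupp_withDensityᵥ {m : Measure G} (hm : IsCompactlyCarried m) {h : G → ℂ}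
    (hh : Integrable h m) : HasCompactSupp (m.withDensityᵥ h) := by
  obtain ⟨C, hC, hmC⟩ := hm
  refine ⟨C, hC, fun A hA hAC => ?_⟩
  rw [withDensityᵥ_apply hh hA]
  exact setIntegral_measure_zero _ (measure_mono_null hAC.subset_compl_right hmC)

/-- A compactly supported complex measure is `h dm` for a finite, compactly carried positive
measure `m`, namely its variation. -/
theorem HasCompactSupp.exists_eq_withDensityᵥ {μ : ComplexMeasure G} (hμ : HasCompactSupp μ) :
    ∃ (m : Measure G) (h : G → ℂ), IsFiniteMeasure m ∧ IsCompactlyCarried m ∧ Integrable h m ∧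
      μ = m.withDensityᵥ h := by
  obtain ⟨h, hh, hμh⟩ := exists_integrable_withDensityᵥ_variation_eq μ
  obtain ⟨C, hC, hμC⟩ := hμ
  refine ⟨_, h, inferInstance, ⟨C, hC, ?_⟩, hh, hμh⟩
  rw [VectorMeasure.variation_apply_eq_zero hC.measurableSet.compl]
  intro A hA hAm
  exact hμC A hAm (disjoint_left.2 fun x hx => hA hx)

theorem pairing_add {μ ν : ComplexMeasure G} (hμ : HasCompactSupp μ) (hν : HasCompactSupp ν)
    {f : G → ℂ} (hf : Continuous f) : pairing f (μ + ν) = pairing f μ + pairing f ν := by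
  obtain ⟨m, h, _, hm, hh, rfl⟩ := hμ.exists_eq_withDensityᵥ
  obtain ⟨n, k, _, hn, hk, rfl⟩ := hν.exists_eq_withDensityᵥ
  exact VectorMeasure.integral_add_vectorMeasure (integral_mul_withDensityᵥ hm hf hh).1
    (integral_mul_withDensityᵥ hn hf hk).1

theorem pairing_smul (c : ℂ) {μ : ComplexMeasure G} (hμ : HasCompactSupp μ)
    {f : G → ℂ} (hf : Continuous f) : pairing f (c • μ) = c * pairing f μ := by
  obtain ⟨m, h, _, hm, hh, rfl⟩ := hμ.exists_eq_withDensityᵥ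
  rw [← withDensityᵥ_smul, pairing_withDensityᵥ hm hf (hh.smul c), pairing_withDensityᵥ hm hf hh,
    ← integral_const_mul]
  refine integral_congr_ae (Filter.Eventually.of_forall fun x => ?_)
  simp only [Pi.smul_apply, smul_eq_mul]
  ring

theorem HasCompactSupp.add {μ ν : ComplexMeasure G} (hμ : HasCompactSupp μ)
    (hν : HasCompactSupp ν) : HasCompactSupp (μ + ν) := by
  obtain ⟨C, hC, hμC⟩ := hμ
  obtain ⟨D, hD, hνD⟩ := hν
  refine ⟨C ∪ D, hC.union hD, fun A hA hd => ?_⟩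
  rw [disjoint_union_right] at hd
  rw [add_apply, hμC A hA hd.1, hνD A hA hd.2, add_zero]

theorem HasCompactSupp.smul (c : ℂ) {μ : ComplexMeasure G} (hμ : HasCompactSupp μ) :
    HasCompactSupp (c • μ) := by
  obtain ⟨C, hC, hμC⟩ := hμ
  exact ⟨C, hC, fun A hA hd => by rw [smul_apply, hμC A hA hd, smul_zero]⟩

/-- The defining formula of the convolution, in terms of densities. -/
theorem pairing_conv_withDensityᵥ {m n : Measure G} [IsFiniteMeasure m] [IsFiniteMeasure n]
    (hm : IsCompactlyCarried m) (hn : IsCompactlyCarried n) {f h k : G → ℂ}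
    (hf : Continuous f) (hh : Integrable h m) (hk : Integrable k n) :
    pairing f (conv (m.withDensityᵥ h) (n.withDensityᵥ k))
      = ∫ p : G × G, f (p.1 * p.2) * (h p.1 * k p.2) ∂(m.prod n) := by
  have hc : Continuous fun p : G × G => f (p.1 * p.2) := by fun_prop
  rw [pairing, conv, prod_withDensityᵥ hh hk]
  obtain ⟨h1, h2⟩ := integral_mul_withDensityᵥ (hm.prod hn) hc (hh.mul_prod hk)
  rw [VectorMeasure.integral_map (by fun_prop) hf.measurable.aestronglyMeasurable h1, h2]

theorem HasCompactSupp.conv {μ ν : ComplexMeasure G} (hμ : HasCompactSupp μ)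
    (hν : HasCompactSupp ν) : HasCompactSupp (conv μ ν) := by
  obtain ⟨m, h, _, hm, hh, rfl⟩ := hμ.exists_eq_withDensityᵥ
  obtain ⟨n, k, _, hn, hk, rfl⟩ := hν.exists_eq_withDensityᵥ
  obtain ⟨C, hC, hmC⟩ := hm.prod hn
  refine ⟨(fun p : G × G => p.1 * p.2) '' C, hC.image continuous_mul, fun A hA hd => ?_⟩
  rw [Pompeiu.conv, VectorMeasure.map_apply _ (by fun_prop) hA, prod_withDensityᵥ hh hk,
    withDensityᵥ_apply (hh.mul_prod hk) (measurable_mul hA)]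
  have hs : (fun p : G × G => p.1 * p.2) ⁻¹' A ⊆ Cᶜ :=
    fun p hp hpC => disjoint_left.1 hd hp ⟨p, hpC, rfl⟩
  exact setIntegral_measure_zero _ (measure_mono_null hs hmC)

theorem pairing_reflect {μ : ComplexMeasure G} (hμ : HasCompactSupp μ) {f : G → ℂ}
    (hf : Continuous f) : pairing f (reflect μ) = pairing (fun x => f x⁻¹) μ := by
  obtain ⟨m, h, _, hm, hh, rfl⟩ := hμ.exists_eq_withDensityᵥ
  have hc : Continuous fun x : G => f x⁻¹ := by fun_prop
  exact VectorMeasure.integral_map measurable_inv hf.measurable.aestronglyMeasurable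
    (integral_mul_withDensityᵥ hm hc hh).1

/-- A compactly supported complex measure is `K`-biinvariant if and only if it is invariant under
left and right translation by elements of `K`. -/
theorem mem_biinvMeasures_iff (K : Subgroup G) [CompactSpace K] {μ : ComplexMeasure G} :
    μ ∈ biinvMeasures K ↔ HasCompactSupp μ ∧
      ∀ f : C(G, ℂ), ∀ k ∈ K, ∀ l ∈ K, pairing (fun x => f (k * x * l)) μ = pairing f μ := by
  refine and_congr_right fun hμ => ⟨fun h f k hk l hl => ?_, fun h f => ?_⟩
  · let g : C(G, ℂ) := ⟨fun x => f (k * x * l), by fun_prop⟩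
    have hg : proj K g = proj K f := by
      ext x
      have h1 : ∀ b : K, ∫ a : K, f (k * ((a : G) * x * (b : G)) * l) ∂(normHaar K) =
          ∫ a : K, f ((a : G) * x * ((b * ⟨l, hl⟩ : K) : G)) ∂(normHaar K) := fun b => by
        refine Eq.trans ?_ (integral_mul_left_eq_self _ (⟨k, hk⟩ : K))
        simp [mul_assoc]
      change ∫ b : K, ∫ a : K, f (k * ((a : G) * x * (b : G)) * l) ∂(normHaar K) ∂(normHaar K) = _
      simp_rw [h1]
      exact integral_mul_right_eq_self (μ := normHaar K)
        (fun b : K => ∫ a : K, f ((a : G) * x * (b : G)) ∂(normHaar K)) (⟨l, hl⟩ : K)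
    have := h g
    rw [hg, ← h f] at this
    exact this
  · have : SecondCountableTopology K := TopologicalSpace.Subtype.secondCountableTopology (K : Set G)
    obtain ⟨m, d, _, hm, hd, rfl⟩ := hμ.exists_eq_withDensityᵥ
    have hK := isCompactlyCarried_of_compactSpace ((normHaar K).prod (normHaar K))
    have h1 : ∀ x, proj K f x = ∫ p : K × K, f ((p.2 : G) * x * (p.1 : G))
        ∂((normHaar K).prod (normHaar K)) := fun x => by
      rw [integral_prod]
      · rfl
      · exact Continuous.integrable_of_isCompactlyCarried hK (by fun_prop)
    rw [pairing_withDensityᵥ hm (proj K f).continuous hd]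
    simp_rw [h1, ← integral_mul_const]
    rw [integral_integral_swap]
    · have h2 : ∀ p : K × K, ∫ x, f ((p.2 : G) * x * (p.1 : G)) * d x ∂m
          = pairing f (m.withDensityᵥ d) := fun p => by
        rw [← pairing_withDensityᵥ hm (by fun_prop) hd, h f _ p.2.2 _ p.1.2]
      simp [h2]
    · exact Continuous.integrable_mul (hm.prod hK)
        (F := fun q : G × (K × K) => f ((q.2.2 : G) * q.1 * (q.2.1 : G))) (by fun_prop)
        (hd.comp_fst _)

/-! ### Convolution of positive measures -/

/-- A finite positive measure, regarded as a complex measure. -/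
noncomputable def ofMeasure {X : Type*} [MeasurableSpace X] (m : Measure X) : ComplexMeasure X :=
  m.withDensityᵥ fun _ => (1 : ℂ)

theorem map_ofMeasure {X Y : Type*} [MeasurableSpace X] [MeasurableSpace Y] (m : Measure X)
    [IsFiniteMeasure m] {φ : X → Y} (hφ : Measurable φ) :
    VectorMeasure.map (ofMeasure m) φ = ofMeasure (m.map φ) := by
  ext s hs
  rw [VectorMeasure.map_apply _ hφ hs, ofMeasure, ofMeasure,
    withDensityᵥ_apply (integrable_const _) (hφ hs), withDensityᵥ_apply (integrable_const _) hs,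
    setIntegral_map hs (by fun_prop) hφ.aemeasurable]

theorem conv_ofMeasure (m n : Measure G) [IsFiniteMeasure m] [IsFiniteMeasure n] :
    conv (ofMeasure m) (ofMeasure n) = ofMeasure (m ∗ₘ n) := by
  have h : VectorMeasure.prod (ofMeasure m) (ofMeasure n) (ContinuousLinearMap.mul ℝ ℂ)
      = ofMeasure (m.prod n) := by
    rw [ofMeasure, ofMeasure, prod_withDensityᵥ (integrable_const _) (integrable_const _)]
    simp [ofMeasure]
  rw [conv, h, map_ofMeasure _ measurable_mul]
  rfl

theorem pairing_ofMeasure {m : Measure G} [IsFiniteMeasure m] (hm : IsCompactlyCarried m)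
    {f : G → ℂ} (hf : Continuous f) : pairing f (ofMeasure m) = ∫ x, f x ∂m := by
  rw [ofMeasure, pairing_withDensityᵥ hm hf (integrable_const _)]
  simp

theorem hasCompactSupp_ofMeasure {m : Measure G} [IsFiniteMeasure m] (hm : IsCompactlyCarried m) :
    HasCompactSupp (ofMeasure m) :=
  hasCompactSupp_withDensityᵥ hm (integrable_const _)

theorem IsCompactlyCarried.mconv {m n : Measure G} [IsFiniteMeasure m] [IsFiniteMeasure n]
    (hm : IsCompactlyCarried m) (hn : IsCompactlyCarried n) : IsCompactlyCarried (m ∗ₘ n) :=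
  (hm.prod hn).map continuous_mul

theorem isCompactlyCarried_dirac (g : G) : IsCompactlyCarried (Measure.dirac g) :=
  ⟨{g}, isCompact_singleton, by simp⟩

theorem integral_mconv_of_continuous {m n : Measure G} [IsFiniteMeasure m] [IsFiniteMeasure n]
    (hm : IsCompactlyCarried m) (hn : IsCompactlyCarried n) {f : G → ℂ} (hf : Continuous f) :
    ∫ z, f z ∂(m ∗ₘ n) = ∫ x, ∫ y, f (x * y) ∂n ∂m :=
  integral_mconv (Continuous.integrable_of_isCompactlyCarried (hm.mconv hn) hf)

/-! ### The Haar measure of the compact subgroup as a measure on the group -/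

/-- The normalized Haar measure of `K`, as a measure on `G`. -/
noncomputable def haarOn (K : Subgroup G) [CompactSpace K] : Measure G :=
  (normHaar K).map Subtype.val

section haarOn

variable (K : Subgroup G) [CompactSpace K]

instance : IsProbabilityMeasure (haarOn K) :=
  Measure.isProbabilityMeasure_map measurable_subtype_coe.aemeasurable

theorem isCompactlyCarried_haarOn : IsCompactlyCarried (haarOn K) :=
  (isCompactlyCarried_of_compactSpace (normHaar K)).map continuous_subtype_val

theorem integral_haarOn {f : G → ℂ} (hf : Continuous f) :
    ∫ x, f x ∂(haarOn K) = ∫ k : K, f k ∂(normHaar K) :=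
  integral_map measurable_subtype_coe.aemeasurable hf.measurable.aestronglyMeasurable

theorem dirac_mconv_haarOn {k : G} (hk : k ∈ K) : Measure.dirac k ∗ₘ haarOn K = haarOn K := by
  rw [Measure.dirac_mconv, haarOn, Measure.map_map (by fun_prop) (by fun_prop)]
  conv_rhs => rw [← map_mul_left_eq_self (normHaar K) (⟨k, hk⟩ : K)]
  rw [Measure.map_map (by fun_prop) (by fun_prop)]
  rfl

theorem haarOn_mconv_dirac {k : G} (hk : k ∈ K) : haarOn K ∗ₘ Measure.dirac k = haarOn K := by
  rw [Measure.mconv_dirac, haarOn, Measure.map_map (by fun_prop) (by fun_prop)]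
  conv_rhs => rw [← map_mul_right_eq_self (normHaar K) (⟨k, hk⟩ : K)]
  rw [Measure.map_map (by fun_prop) (by fun_prop)]
  rfl

theorem haarOn_mconv_haarOn : haarOn K ∗ₘ haarOn K = haarOn K := by
  refine Measure.ext_of_lintegral _ fun f hf => ?_
  have h1 : ∀ k : K, ∫⁻ y, f (k * y) ∂(haarOn K) = ∫⁻ y, f y ∂(haarOn K) := fun k => by
    conv_rhs => rw [← dirac_mconv_haarOn K k.2, Measure.dirac_mconv, lintegral_map hf (by fun_prop)]
  rw [Measure.lintegral_mconv hf]
  conv_lhs => rw [haarOn]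
  rw [lintegral_map (Measurable.lintegral_prod_right (by fun_prop)) measurable_subtype_coe]
  change ∫⁻ k : K, ∫⁻ y, f (k * y) ∂(haarOn K) ∂(normHaar K) = _
  simp [h1]

variable {K}

theorem integral_haarOn_mconv {f : C(G, ℂ)} (hf : f ∈ biinvFunctions K) {m : Measure G}
    [IsFiniteMeasure m] (hm : IsCompactlyCarried m) :
    ∫ x, f x ∂(haarOn K ∗ₘ m) = ∫ x, f x ∂m := by
  have h : ∀ x, ∫ k, f (k * x) ∂(haarOn K) = f x := fun x => by
    rw [integral_haarOn K (by fun_prop)]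
    have : ∀ k : K, f (k * x) = f x := fun k => by simpa using hf k k.2 1 K.one_mem x
    simp [this]
  rw [integral_mconv_of_continuous (isCompactlyCarried_haarOn K) hm f.continuous,
    integral_integral_swap]
  · simp [h]
  · exact Continuous.integrable_of_isCompactlyCarried
      ((isCompactlyCarried_haarOn K).prod hm) (F := fun p : G × G => f (p.1 * p.2)) (by fun_prop)

theorem integral_mconv_haarOn {f : C(G, ℂ)} (hf : f ∈ biinvFunctions K) {m : Measure G}
    [IsFiniteMeasure m] (hm : IsCompactlyCarried m) :
    ∫ x, f x ∂(m ∗ₘ haarOn K) = ∫ x, f x ∂m := by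
  rw [integral_mconv_of_continuous hm (isCompactlyCarried_haarOn K) f.continuous]
  congr 1 with x
  rw [integral_haarOn K (f := fun y => f (x * y)) (by fun_prop)]
  have : ∀ k : K, f (x * k) = f x := fun k => by simpa using hf 1 K.one_mem k k.2 x
  simp [this]

/-- A positive measure invariant under translations by `K` on both sides is biinvariant. -/
theorem ofMeasure_mem_biinvMeasures {m : Measure G} [IsFiniteMeasure m]
    (hm : IsCompactlyCarried m) (hl : ∀ k ∈ K, Measure.dirac k ∗ₘ m = m)
    (hr : ∀ k ∈ K, m ∗ₘ Measure.dirac k = m) : ofMeasure m ∈ biinvMeasures K := by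
  refine (mem_biinvMeasures_iff K).2
    ⟨hasCompactSupp_ofMeasure hm, fun f k hk l hl' => ?_⟩
  rw [pairing_ofMeasure hm (by fun_prop), pairing_ofMeasure hm (by fun_prop)]
  conv_rhs => rw [← hl k hk, Measure.dirac_mconv,
    integral_map (by fun_prop) f.continuous.measurable.aestronglyMeasurable,
    ← hr l hl', Measure.mconv_dirac, integral_map (by fun_prop)
      (f := fun y => f (k * y)) (by fun_prop)]
  simp [mul_assoc]

theorem haarOn_mconv_mconv_haarOn_mem (m : Measure G) [IsFiniteMeasure m]
    (hm : IsCompactlyCarried m) :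
    ofMeasure (haarOn K ∗ₘ (m ∗ₘ haarOn K)) ∈ biinvMeasures K := by
  have hK := isCompactlyCarried_haarOn K
  refine ofMeasure_mem_biinvMeasures (hK.mconv (hm.mconv hK)) (fun k hk => ?_) fun k hk => ?_
  · rw [← Measure.mconv_assoc, dirac_mconv_haarOn K hk]
  · rw [Measure.mconv_assoc, Measure.mconv_assoc, haarOn_mconv_dirac K hk]

/-- For a Gelfand pair, biinvariant functions do not distinguish between `m * dk * n` and
`n * dk * m`: these are the convolutions, in the two orders, of the biinvariant averages of `m`
and `n`, up to outer factors `dk`. -/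
theorem IsGelfandPair.integral_mconv_comm (hG : IsGelfandPair K) {f : C(G, ℂ)}
    (hf : f ∈ biinvFunctions K) {m n : Measure G} [IsFiniteMeasure m] [IsFiniteMeasure n]
    (hm : IsCompactlyCarried m) (hn : IsCompactlyCarried n) :
    ∫ x, f x ∂(m ∗ₘ (haarOn K ∗ₘ n)) = ∫ x, f x ∂(n ∗ₘ (haarOn K ∗ₘ m)) := by
  have hK := isCompactlyCarried_haarOn K
  have key : ∀ {m n : Measure G} [IsFiniteMeasure m] [IsFiniteMeasure n],
      IsCompactlyCarried m → IsCompactlyCarried n →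
      pairing f (conv (ofMeasure (haarOn K ∗ₘ (m ∗ₘ haarOn K)))
        (ofMeasure (haarOn K ∗ₘ (n ∗ₘ haarOn K)))) = ∫ x, f x ∂(m ∗ₘ (haarOn K ∗ₘ n)) := by
    intro m n _ _ hm hn
    have h1 : (haarOn K ∗ₘ (m ∗ₘ haarOn K)) ∗ₘ (haarOn K ∗ₘ (n ∗ₘ haarOn K))
        = haarOn K ∗ₘ ((m ∗ₘ (haarOn K ∗ₘ n)) ∗ₘ haarOn K) := by
      simp only [Measure.mconv_assoc]
      rw [← Measure.mconv_assoc (haarOn K) (haarOn K), haarOn_mconv_haarOn]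
    have h2 := hm.mconv (hK.mconv hn)
    rw [conv_ofMeasure, h1, pairing_ofMeasure (hK.mconv (h2.mconv hK)) f.continuous,
      integral_haarOn_mconv hf (h2.mconv hK), integral_mconv_haarOn hf h2]
  rw [← key hm hn, ← key hn hm, hG _ (haarOn_mconv_mconv_haarOn_mem m hm) _
    (haarOn_mconv_mconv_haarOn_mem n hn)]

end haarOn

/-! ### The algebra of biinvariant measures and spherical functions -/

section Algebra

variable {K : Subgroup G} [CompactSpace K]

theorem add_mem_biinvMeasures {μ ν : ComplexMeasure G} (hμ : μ ∈ biinvMeasures K)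
    (hν : ν ∈ biinvMeasures K) : μ + ν ∈ biinvMeasures K :=
  ⟨hμ.1.add hν.1, fun f => by
    rw [pairing_add hμ.1 hν.1 f.continuous, pairing_add hμ.1 hν.1 (proj K f).continuous,
      hμ.2 f, hν.2 f]⟩

theorem smul_mem_biinvMeasures (c : ℂ) {μ : ComplexMeasure G} (hμ : μ ∈ biinvMeasures K) :
    c • μ ∈ biinvMeasures K :=
  ⟨hμ.1.smul c, fun f => by
    rw [pairing_smul c hμ.1 f.continuous, pairing_smul c hμ.1 (proj K f).continuous, hμ.2 f]⟩

theorem zero_mem_biinvMeasures : (0 : ComplexMeasure G) ∈ biinvMeasures K :=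
  ⟨⟨∅, isCompact_empty, fun _ _ _ => rfl⟩, fun f => by simp [pairing]⟩

theorem conv_mem_biinvMeasures {μ ν : ComplexMeasure G} (hμ : μ ∈ biinvMeasures K)
    (hν : ν ∈ biinvMeasures K) : conv μ ν ∈ biinvMeasures K := by
  refine (mem_biinvMeasures_iff K).2 ⟨hμ.1.conv hν.1, fun f k hk l hl => ?_⟩
  obtain ⟨hμc, hμi⟩ := (mem_biinvMeasures_iff K).1 hμ
  obtain ⟨hνc, hνi⟩ := (mem_biinvMeasures_iff K).1 hν
  obtain ⟨m, h, _, hm, hh, rfl⟩ := hμc.exists_eq_withDensityᵥ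
  obtain ⟨n, d, _, hn, hd, rfl⟩ := hνc.exists_eq_withDensityᵥ
  have hint : ∀ F : G × G → ℂ, Continuous F →
      Integrable (fun p => F p * (h p.1 * d p.2)) (m.prod n) := fun F hF =>
    Continuous.integrable_mul (hm.prod hn) hF (hh.mul_prod hd)
  have hleft : ∀ y, ∫ x, f (k * (x * y) * l) * h x ∂m = ∫ x, f (x * (y * l)) * h x ∂m := by
    intro y
    have := hμi ⟨fun x => f (x * (y * l)), by fun_prop⟩ k hk 1 K.one_mem
    rw [pairing_withDensityᵥ hm (by fun_prop) hh, pairing_withDensityᵥ hm (by fun_prop) hh] at this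
    simpa [mul_assoc] using this
  have hright : ∀ x, ∫ y, f (x * (y * l)) * d y ∂n = ∫ y, f (x * y) * d y ∂n := by
    intro x
    have := hνi ⟨fun y => f (x * y), by fun_prop⟩ 1 K.one_mem l hl
    rw [pairing_withDensityᵥ hn (by fun_prop) hd, pairing_withDensityᵥ hn (by fun_prop) hd] at this
    simpa [mul_assoc] using this
  rw [pairing_conv_withDensityᵥ hm hn (by fun_prop) hh hd,
    pairing_conv_withDensityᵥ hm hn (by fun_prop) hh hd]
  calc ∫ p : G × G, f (k * (p.1 * p.2) * l) * (h p.1 * d p.2) ∂(m.prod n)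
      = ∫ y, ∫ x, f (k * (x * y) * l) * (h x * d y) ∂m ∂n :=
        integral_prod_symm _ (hint (fun p => f (k * (p.1 * p.2) * l)) (by fun_prop))
    _ = ∫ y, ∫ x, f (x * (y * l)) * (h x * d y) ∂m ∂n := by
        simp_rw [← mul_assoc (f _), integral_mul_const, hleft]
    _ = ∫ p : G × G, f (p.1 * (p.2 * l)) * (h p.1 * d p.2) ∂(m.prod n) :=
        (integral_prod_symm _ (hint (fun p => f (p.1 * (p.2 * l))) (by fun_prop))).symm
    _ = ∫ x, ∫ y, f (x * (y * l)) * (h x * d y) ∂n ∂m :=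
        integral_prod _ (hint (fun p => f (p.1 * (p.2 * l))) (by fun_prop))
    _ = ∫ x, ∫ y, f (x * y) * (h x * d y) ∂n ∂m := by
        simp_rw [mul_comm (h _), ← mul_assoc (f _), integral_mul_const, hright]
    _ = ∫ p : G × G, f (p.1 * p.2) * (h p.1 * d p.2) ∂(m.prod n) :=
        (integral_prod _ (hint (fun p => f (p.1 * p.2)) (by fun_prop))).symm

theorem transform_eq {μ : ComplexMeasure G} (hμ : HasCompactSupp μ) (f : C(G, ℂ)) :
    transform f μ = pairing (fun x => f x⁻¹) μ :=
  pairing_reflect hμ f.continuous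

/-- The functional equation of a spherical function, integrated against a biinvariant measure. -/
theorem pairing_mul_inv_of_spherical {s : C(G, ℂ)} (hs : s ∈ sphericalFunctions K)
    {μ : ComplexMeasure G} (hμ : μ ∈ biinvMeasures K) (y : G) :
    pairing (fun x => s (y * x⁻¹)) μ = s y * transform s μ := by
  rw [transform_eq hμ.1]
  obtain ⟨hμc, hμi⟩ := (mem_biinvMeasures_iff K).1 hμ
  obtain ⟨m, h, _, hm, hh, rfl⟩ := hμc.exists_eq_withDensityᵥ
  have h1 : ∀ c : K, ∫ x, s (y * (c : G) * x⁻¹) * h x ∂m = ∫ x, s (y * x⁻¹) * h x ∂m := by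
    intro c
    have := hμi ⟨fun x => s (y * x⁻¹), by fun_prop⟩ 1 K.one_mem (c : G)⁻¹ (K.inv_mem c.2)
    rw [pairing_withDensityᵥ hm (by fun_prop) hh, pairing_withDensityᵥ hm (by fun_prop) hh] at this
    simpa [mul_assoc] using this
  have h2 : ∀ x, ∫ c : K, s (y * (c : G) * x⁻¹) * h x ∂(normHaar K) = s y * (s x⁻¹ * h x) := by
    intro x
    rw [integral_mul_const, hs.2.2, mul_assoc]
  rw [pairing_withDensityᵥ hm (by fun_prop) hh, pairing_withDensityᵥ hm (by fun_prop) hh]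
  calc ∫ x, s (y * x⁻¹) * h x ∂m
      = ∫ c : K, ∫ x, s (y * (c : G) * x⁻¹) * h x ∂m ∂(normHaar K) := by simp [h1]
    _ = ∫ x, ∫ c : K, s (y * (c : G) * x⁻¹) * h x ∂(normHaar K) ∂m := by
        rw [integral_integral_swap]
        have : SecondCountableTopology K :=
          TopologicalSpace.Subtype.secondCountableTopology (K : Set G)
        exact Continuous.integrable_mul ((isCompactlyCarried_of_compactSpace (normHaar K)).prod hm)
          (F := fun p : K × G => s (y * (p.1 : G) * p.2⁻¹)) (by fun_prop) (hh.comp_snd _)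
    _ = s y * ∫ x, s x⁻¹ * h x ∂m := by simp_rw [h2, integral_const_mul]

/-- The transform at a spherical function is multiplicative. -/
theorem transform_conv {s : C(G, ℂ)} (hs : s ∈ sphericalFunctions K) {μ ν : ComplexMeasure G}
    (hμ : μ ∈ biinvMeasures K) (hν : ν ∈ biinvMeasures K) :
    transform s (conv μ ν) = transform s μ * transform s ν := by
  have h1 := pairing_mul_inv_of_spherical hs hμ
  rw [transform_eq (hμ.1.conv hν.1), transform_eq hν.1]
  obtain ⟨m, h, _, hm, hh, rfl⟩ := hμ.1.exists_eq_withDensityᵥ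
  obtain ⟨n, d, _, hn, hd, rfl⟩ := hν.1.exists_eq_withDensityᵥ
  rw [pairing_conv_withDensityᵥ hm hn (f := fun x => s x⁻¹) (by fun_prop) hh hd,
    pairing_withDensityᵥ hn (by fun_prop) hd, integral_prod_symm, ← integral_const_mul]
  · congr 1 with y
    have h2 := h1 y⁻¹
    rw [pairing_withDensityᵥ hm (by fun_prop) hh] at h2
    simp_rw [mul_inv_rev, ← mul_assoc, integral_mul_const, h2]
    ring
  · exact Continuous.integrable_mul (hm.prod hn) (F := fun p : G × G => s (p.1 * p.2)⁻¹)
      (by fun_prop) (hh.mul_prod hd)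

/-- The biinvariant measures annihilated by the transform at a spherical function form an ideal. -/
theorem exists_isIdeal_transform_eq_zero {s : C(G, ℂ)} (hs : s ∈ sphericalFunctions K) :
    ∃ J : Submodule ℂ (ComplexMeasure G), IsIdeal K J ∧
      ∀ μ, μ ∈ J ↔ μ ∈ biinvMeasures K ∧ transform s μ = 0 := by
  have hc : Continuous fun x => s x⁻¹ := by fun_prop
  refine ⟨{ carrier := {μ | μ ∈ biinvMeasures K ∧ transform s μ = 0}
            add_mem' := ?_
            zero_mem' := ?_
            smul_mem' := ?_ }, ⟨fun μ hμ => hμ.1, ?_, ?_⟩, fun μ => Iff.rfl⟩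
  · rintro μ ν ⟨hμ, hμ0⟩ ⟨hν, hν0⟩
    have h := add_mem_biinvMeasures hμ hν
    refine ⟨h, ?_⟩
    rw [transform_eq hμ.1] at hμ0
    rw [transform_eq hν.1] at hν0
    rw [transform_eq h.1, pairing_add hμ.1 hν.1 hc, hμ0, hν0, add_zero]
  · refine ⟨zero_mem_biinvMeasures, ?_⟩
    rw [transform_eq (zero_mem_biinvMeasures (K := K)).1]
    simp [pairing]
  · rintro c μ ⟨hμ, hμ0⟩
    have h := smul_mem_biinvMeasures c hμ
    refine ⟨h, ?_⟩
    rw [transform_eq hμ.1] at hμ0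
    rw [transform_eq h.1, pairing_smul c hμ.1 hc, hμ0, mul_zero]
  · rintro μ ⟨hμ, hμ0⟩ ν hν
    exact ⟨conv_mem_biinvMeasures hμ hν, by rw [transform_conv hs hμ hν, hμ0, zero_mul]⟩
  · rintro μ ⟨hμ, hμ0⟩ ν hν
    exact ⟨conv_mem_biinvMeasures hν hμ, by rw [transform_conv hs hν hμ, hμ0, mul_zero]⟩

end Algebra

/-! ### Integrals over translates -/

section Translates

variable (dx : Measure G) [dx.IsHaarMeasure] {A : Set G}

theorem isFiniteMeasure_restrict_of_isCompact (hA : IsCompact A) :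
    IsFiniteMeasure (dx.restrict A) :=
  ⟨by rw [Measure.restrict_apply_univ]; exact hA.measure_lt_top⟩

theorem setIntegral_smul_set (hA : IsCompact A) (g : G) (f : G → ℂ) :
    ∫ x in g • A, f x ∂dx = ∫ x in A, f (g * x) ∂dx := by
  rw [← integral_indicator hA.measurableSet, ← integral_indicator (hA.smul g).measurableSet,
    ← integral_mul_left_eq_self _ g]
  congr 1 with x
  have : g * x ∈ g • A ↔ x ∈ A := smul_mem_smul_set_iff (a := g)
  by_cases hx : x ∈ A
  · rw [indicator_of_mem hx, indicator_of_mem (this.2 hx)]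
  · rw [indicator_of_notMem hx, indicator_of_notMem (fun h => hx (this.1 h))]

theorem setIntegral_inv_set [dx.IsMulRightInvariant] (hA : IsCompact A) (f : G → ℂ) :
    ∫ x in A⁻¹, f x⁻¹ ∂dx = ∫ x in A, f x ∂dx := by
  have := isInvInvariant_of_isMulRightInvariant dx
  rw [← integral_indicator hA.measurableSet, ← integral_indicator hA.inv.measurableSet,
    ← integral_inv_eq_self _ dx]
  congr 1 with x
  by_cases hx : x ∈ A <;> simp [hx]

theorem continuous_setIntegral_of_isCompact (hA : IsCompact A) :
    Continuous fun f : C(G, ℂ) => ∫ x in A, f x ∂dx := by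
  refine continuous_iff_continuousAt.2 fun f₀ => Metric.tendsto_nhds.2 fun ε hε => ?_
  have h := ContinuousMap.tendsto_iff_forall_isCompact_tendstoUniformlyOn.1
    (Filter.tendsto_id (α := C(G, ℂ)) (x := 𝓝 f₀)) A hA
  set c := dx.real A with hc
  have hc0 : 0 ≤ c := measureReal_nonneg
  have hδ : 0 < ε / (c + 1) := by positivity
  filter_upwards [Metric.tendstoUniformlyOn_iff.1 h _ hδ] with f hf
  rw [dist_comm, dist_eq_norm, ← integral_sub
    (f₀.continuous.continuousOn.integrableOn_compact hA)
    (f.continuous.continuousOn.integrableOn_compact hA)]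
  refine (norm_setIntegral_le_of_norm_le_const hA.measure_lt_top
    (C := ε / (c + 1)) fun x hx => ?_).trans_lt ?_
  · rw [← dist_eq_norm]
    exact (hf x hx).le
  · rw [← hc, div_mul_eq_mul_div, div_lt_iff₀ (by positivity)]
    nlinarith

end Translates

/-! ### The homogeneous space -/

section Homogeneous

variable {K : Subgroup G} [CompactSpace K]

/-- The projection along a compact subgroup is proper, so lifts of compact sets are compact. -/
theorem isCompact_lift {E : Set (G ⧸ K)} (hE : IsCompact E) : IsCompact (lift K E) := by
  have hK : IsCompact (K : Set G) := isCompact_iff_compactSpace.2 inferInstance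
  have hp : IsProperMap (fun x : G => (x : G ⧸ K)) := by
    refine isProperMap_iff_isClosedMap_and_compact_fibers.2
      ⟨continuous_quotient_mk', QuotientGroup.isClosedMap_coe hK, fun y => ?_⟩
    obtain ⟨g, rfl⟩ := QuotientGroup.mk_surjective y
    have : (fun x : G => (x : G ⧸ K)) ⁻¹' {(g : G ⧸ K)} = g • (K : Set G) := by
      ext x
      rw [mem_preimage, mem_singleton_iff, eq_comm, QuotientGroup.eq, mem_smul_set_iff_inv_smul_mem]
      rfl
    rw [this]
    exact hK.smul g
  exact hp.isCompact_preimage hE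

theorem lift_mul_mem_iff {E : Set (G ⧸ K)} (x : G) {k : G} (hk : k ∈ K) :
    x * k ∈ lift K E ↔ x ∈ lift K E := by
  simp only [lift, mem_ofPred_eq]
  rw [QuotientGroup.mk_mul_of_mem x hk]

theorem preimage_smul_eq_smul_lift (E : Set (G ⧸ K)) (g : G) :
    (fun x : G => (x : G ⧸ K)) ⁻¹' (g • E) = g • lift K E := by
  ext x
  rw [mem_preimage, mem_smul_set_iff_inv_smul_mem, mem_smul_set_iff_inv_smul_mem]
  rfl

theorem setIntegral_quotientMeasure (dx : Measure G) {E : Set (G ⧸ K)} (hE : IsCompact E)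
    (f : C(G ⧸ K, ℂ)) (g : G) :
    ∫ x in g • E, f x ∂(quotientMeasure dx K) = ∫ x in g • lift K E, f (x : G ⧸ K) ∂dx := by
  have hmk : Measurable (fun x : G => (x : G ⧸ K)) := measurable_quotient_mk''
  have hf : Measurable f := by
    refine measurable_from_quotient.2 ?_
    exact (f.continuous.comp continuous_quotient_mk').measurable
  have hm : MeasurableSet (g • E) := by
    refine measurableSet_quotient.2 ?_
    have := preimage_smul_eq_smul_lift E g
    exact this ▸ ((isCompact_lift hE).smul g).measurableSet
  rw [quotientMeasure, setIntegral_map hm hf.aestronglyMeasurable hmk.aemeasurable,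
    preimage_smul_eq_smul_lift]

end Homogeneous

/-! ### The generators of the ideal -/

section Generators

variable (dx : Measure G) [dx.IsHaarMeasure] {K : Subgroup G} [CompactSpace K] {A : Set G}

theorem reflectedIndicator_eq (hA : IsCompact A) :
    reflectedIndicator dx A = ofMeasure (dx.restrict A⁻¹) := by
  have := isFiniteMeasure_restrict_of_isCompact dx hA.inv
  have h1 : (fun x : G => A.indicator (fun _ => (1 : ℂ)) x⁻¹) = A⁻¹.indicator fun _ => 1 := rfl
  have h2 : Integrable (A⁻¹.indicator fun _ => (1 : ℂ)) dx :=
    (integrable_indicator_iff hA.inv.measurableSet).2 (integrable_const _)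
  ext s hs
  rw [reflectedIndicator, ofMeasure, h1, withDensityᵥ_apply h2 hs,
    withDensityᵥ_apply (integrable_const _) hs, integral_indicator hA.inv.measurableSet,
    Measure.restrict_restrict hs, Measure.restrict_restrict hA.inv.measurableSet, inter_comm]

theorem cosetMeasure_eq (g : G) :
    cosetMeasure K g = ofMeasure (Measure.dirac g ∗ₘ haarOn K) := by
  rw [Measure.dirac_mconv, haarOn, Measure.map_map (by fun_prop) (by fun_prop)]
  exact map_ofMeasure (normHaar K) (by fun_prop)

theorem isCompactlyCarried_generator (hA : IsCompact A) (g : G) :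
    IsCompactlyCarried (dx.restrict A⁻¹ ∗ₘ (Measure.dirac g ∗ₘ haarOn K)) := by
  have := isFiniteMeasure_restrict_of_isCompact dx hA.inv
  exact (isCompactlyCarried_restrict dx hA.inv).mconv
    ((isCompactlyCarried_dirac g).mconv (isCompactlyCarried_haarOn K))

theorem conv_reflectedIndicator_cosetMeasure (hA : IsCompact A) (g : G) :
    conv (reflectedIndicator dx A) (cosetMeasure K g)
      = ofMeasure (dx.restrict A⁻¹ ∗ₘ (Measure.dirac g ∗ₘ haarOn K)) := by
  have := isFiniteMeasure_restrict_of_isCompact dx hA.inv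
  rw [reflectedIndicator_eq dx hA, cosetMeasure_eq, conv_ofMeasure]

theorem conv_reflectedIndicator_cosetMeasure_mem (hA : IsCompact A)
    (hAK : ∀ x, ∀ k ∈ K, (x * k ∈ A ↔ x ∈ A)) (g : G) :
    conv (reflectedIndicator dx A) (cosetMeasure K g) ∈ biinvMeasures K := by
  have := isFiniteMeasure_restrict_of_isCompact dx hA.inv
  rw [conv_reflectedIndicator_cosetMeasure dx hA]
  refine ofMeasure_mem_biinvMeasures (isCompactlyCarried_generator dx hA g) (fun k hk => ?_)
    fun k hk => ?_
  · rw [← Measure.mconv_assoc]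
    congr 1
    ext s hs
    rw [Measure.dirac_mconv, Measure.map_apply (by fun_prop) hs, Measure.restrict_apply hs,
      Measure.restrict_apply (measurable_const_mul k hs), ← measure_preimage_mul dx k (s ∩ A⁻¹)]
    congr 1
    ext x
    simp only [mem_inter_iff, mem_preimage, mem_inv, mul_inv_rev, hAK _ _ (K.inv_mem hk)]
  · rw [Measure.mconv_assoc, Measure.mconv_assoc, haarOn_mconv_dirac K hk]

/-- The transform of the generator attached to `g`, evaluated at `f`, is an integral of `f` over a
translate. -/
theorem transform_generator [dx.IsMulRightInvariant] (hA : IsCompact A) (g : G) {f : C(G, ℂ)}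
    (hf : f ∈ biinvFunctions K) :
    transform f (conv (reflectedIndicator dx A) (cosetMeasure K g))
      = ∫ x in g⁻¹ • A, f x ∂dx := by
  have := isFiniteMeasure_restrict_of_isCompact dx hA.inv
  have hc := isCompactlyCarried_generator dx (K := K) hA g
  have hK := isCompactlyCarried_haarOn K
  have hg := isCompactlyCarried_dirac g
  rw [conv_reflectedIndicator_cosetMeasure dx hA,
    transform_eq (hasCompactSupp_ofMeasure hc),
    pairing_ofMeasure hc (by fun_prop), integral_mconv_of_continuous
      (isCompactlyCarried_restrict dx hA.inv) (hg.mconv hK) (f := fun x => f x⁻¹) (by fun_prop),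
    setIntegral_smul_set dx hA, ← setIntegral_inv_set dx hA]
  congr 1 with x
  rw [integral_mconv_of_continuous hg hK (f := fun y => f (x * y)⁻¹) (by fun_prop), integral_dirac,
    integral_haarOn K (f := fun y => f (x * (g * y))⁻¹) (by fun_prop)]
  have : ∀ k : K, f (x * (g * k))⁻¹ = f (g⁻¹ * x⁻¹) := fun k => by
    have := hf _ (K.inv_mem k.2) 1 K.one_mem (g⁻¹ * x⁻¹)
    rw [← this]
    simp [mul_assoc]
  simp_rw [this]
  simp

end Generators

/-! ### The variety of functions with vanishing integrals over the translates -/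

section Variety

variable (dx : Measure G) [dx.IsHaarMeasure] (K : Subgroup G) [CompactSpace K] {A : Set G}

/-- The biinvariant continuous functions whose integral over every left translate of the compact
set `A` vanishes. -/
noncomputable def vanishingIntegrals (hA : IsCompact A) : Submodule ℂ C(G, ℂ) where
  carrier := {f | f ∈ biinvFunctions K ∧ ∀ g : G, ∫ x in g • A, f x ∂dx = 0}
  add_mem' := by
    rintro f h ⟨hf, hf0⟩ ⟨hh, hh0⟩
    refine ⟨add_mem hf hh, fun g => ?_⟩
    have hg := hA.smul g
    simp only [ContinuousMap.add_apply]
    rw [integral_add (f.continuous.continuousOn.integrableOn_compact hg)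
      (h.continuous.continuousOn.integrableOn_compact hg), hf0, hh0, add_zero]
  zero_mem' := ⟨zero_mem _, fun g => by simp⟩
  smul_mem' := by
    rintro c f ⟨hf, hf0⟩
    refine ⟨Submodule.smul_mem _ c hf, fun g => ?_⟩
    simp only [ContinuousMap.smul_apply]
    rw [integral_smul, hf0, smul_zero]

variable {K}

theorem mem_vanishingIntegrals_iff {hA : IsCompact A} {f : C(G, ℂ)} :
    f ∈ vanishingIntegrals dx K hA ↔
      f ∈ biinvFunctions K ∧ ∀ g : G, ∫ x in g • A, f x ∂dx = 0 :=
  Iff.rfl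

theorem isClosed_biinvFunctions : IsClosed (biinvFunctions K : Set C(G, ℂ)) := by
  have : (biinvFunctions K : Set C(G, ℂ))
      = ⋂ k ∈ K, ⋂ l ∈ K, ⋂ x : G, {f | f (k * x * l) = f x} := by
    ext f
    simp only [mem_iInter]
    rfl
  rw [this]
  refine isClosed_biInter fun k _ => isClosed_biInter fun l _ => isClosed_iInter fun x => ?_
  exact isClosed_eq (continuous_eval_const _) (continuous_eval_const _)

theorem translate_mem_biinvFunctions {f : C(G, ℂ)} (hf : f ∈ biinvFunctions K) (y : G) :
    translate K y f ∈ biinvFunctions K := by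
  intro k hk l hl x
  change ∫ c : K, f (k * x * l * (c : G) * y) ∂(normHaar K) =
    ∫ c : K, f (x * (c : G) * y) ∂(normHaar K)
  rw [← integral_mul_left_eq_self (fun c : K => f (x * (c : G) * y)) (⟨l, hl⟩ : K)]
  congr 1 with c
  have := hf k hk 1 K.one_mem (x * (l * c) * y)
  rw [mul_one] at this
  simpa [mul_assoc] using this

theorem integral_mconv_haarOn_mconv {m n : Measure G} [IsFiniteMeasure m] [IsFiniteMeasure n]
    (hm : IsCompactlyCarried m) (hn : IsCompactlyCarried n) (f : C(G, ℂ)) :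
    ∫ x, f x ∂(m ∗ₘ (haarOn K ∗ₘ n))
      = ∫ x, ∫ z, ∫ y, f (x * (z * y)) ∂n ∂(haarOn K) ∂m := by
  have hK := isCompactlyCarried_haarOn K
  rw [integral_mconv_of_continuous hm (hK.mconv hn) f.continuous]
  congr 1 with x
  rw [integral_mconv_of_continuous hK hn (f := fun y => f (x * y)) (by fun_prop)]

/-- Over a Gelfand pair the functions with vanishing integrals form a variety. The Gelfand property
is what turns the right translations of the definition into left translations, under which the
vanishing of the integrals is preserved. -/
theorem isVariety_vanishingIntegrals (hG : IsGelfandPair K) (hA : IsCompact A) :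
    IsVariety K (vanishingIntegrals dx K hA) where
  le_biinv := fun f hf => hf.1
  isClosed := by
    have : (vanishingIntegrals dx K hA : Set C(G, ℂ))
        = (biinvFunctions K : Set C(G, ℂ)) ∩ ⋂ g : G, {f | ∫ x in g • A, f x ∂dx = 0} := by
      ext f
      simp [mem_vanishingIntegrals_iff]
    rw [this]
    exact isClosed_biinvFunctions.inter (isClosed_iInter fun g => isClosed_eq
      (continuous_setIntegral_of_isCompact dx (hA.smul g)) continuous_const)
  translate_mem := by
    rintro f ⟨hf, hf0⟩ y
    refine ⟨translate_mem_biinvFunctions hf y, fun g => ?_⟩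
    have := isFiniteMeasure_restrict_of_isCompact dx (hA.smul g)
    have hm := isCompactlyCarried_restrict dx (hA.smul g)
    have hy := isCompactlyCarried_dirac y
    have h := hG.integral_mconv_comm hf hm hy
    rw [integral_mconv_haarOn_mconv hm hy, integral_mconv_haarOn_mconv hy hm, integral_dirac] at h
    have h1 : ∀ z : G, ∫ x in g • A, f (y * (z * x)) ∂dx = 0 := fun z => by
      have := hf0 (y * z * g)
      rw [mul_smul, setIntegral_smul_set dx (hA.smul g)] at this
      simpa [mul_assoc] using this
    have h2 : ∀ x : G, ∫ z, ∫ w, f (x * (z * w)) ∂(Measure.dirac y) ∂(haarOn K)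
        = translate K y f x := fun x => by
      simp_rw [integral_dirac]
      rw [integral_haarOn K (f := fun z => f (x * (z * y))) (by fun_prop)]
      simp_rw [← mul_assoc]
      rfl
    simp_rw [h1, h2] at h
    simpa using h

/-- The left average over `K` of a translate of a function on the homogeneous space turns a
counterexample to the Pompeiu property into a nonzero biinvariant function with vanishing
integrals. -/
theorem exists_mem_vanishingIntegrals {E : Set (G ⧸ K)} (hE : IsCompact E) (f : C(G ⧸ K, ℂ))
    (hf : ∀ g : G, ∫ x in g • E, f x ∂(quotientMeasure dx K) = 0) (a : G) :
    ∃ F ∈ vanishingIntegrals dx K (isCompact_lift hE), F 1 = f (a : G ⧸ K) := by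
  have hK : SecondCountableTopology K :=
    TopologicalSpace.Subtype.secondCountableTopology (K : Set G)
  let q : C(G, ℂ) := f.comp ⟨fun x : G => (x : G ⧸ K), continuous_quotient_mk'⟩
  have hq : ∀ x : G, ∀ k ∈ K, q (x * k) = q x := fun x k hk =>
    congrArg f (QuotientGroup.mk_mul_of_mem x hk)
  have hq0 : ∀ g : G, ∫ x in g • lift K E, q x ∂dx = 0 := fun g =>
    (setIntegral_quotientMeasure dx hE f g).symm.trans (hf g)
  have hA := isCompact_lift hE
  have hc : Continuous (Function.uncurry fun (x : G) (k : K) => q (a * k * x)) := by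
    simp only [Function.uncurry_def]
    fun_prop
  refine ⟨⟨fun x => ∫ k : K, q (a * k * x) ∂(normHaar K), continuous_integral_normHaar K hc⟩,
    ⟨fun k hk l hl x => ?_, fun g => ?_⟩, ?_⟩
  · change ∫ c : K, q (a * c * (k * x * l)) ∂(normHaar K) = ∫ c : K, q (a * c * x) ∂(normHaar K)
    rw [← integral_mul_right_eq_self (fun c : K => q (a * c * x)) (⟨k, hk⟩ : K)]
    congr 1 with c
    rw [← mul_assoc (a * c), hq _ l hl]
    simp [mul_assoc]
  · have := isFiniteMeasure_restrict_of_isCompact dx (hA.smul g)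
    change ∫ x in g • lift K E, ∫ k : K, q (a * k * x) ∂(normHaar K) ∂dx = 0
    rw [integral_integral_swap]
    · have h1 : ∀ k : K, ∫ x in g • lift K E, q (a * k * x) ∂dx = 0 := fun k => by
        have := hq0 (a * k * g)
        rwa [mul_smul, setIntegral_smul_set dx (hA.smul g)] at this
      simp [h1]
    · exact Continuous.integrable_of_isCompactlyCarried ((isCompactlyCarried_restrict dx
        (hA.smul g)).prod (isCompactlyCarried_of_compactSpace (normHaar K))) hc
  · change ∫ k : K, q (a * k * 1) ∂(normHaar K) = q a
    have : ∀ k : K, q (a * k * 1) = q a := fun k => by rw [mul_one, hq a k k.2]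
    simp_rw [this]
    simp

end Variety

/-! ### The zero set of the ideal -/

section ZeroSet

variable (dx : Measure G) [dx.IsHaarMeasure] [dx.IsMulRightInvariant] {K : Subgroup G}
  [CompactSpace K]

/-- The zero set of the ideal consists of the spherical functions with vanishing integrals over the
translates of the lift of `E`. -/
theorem mem_zeroSet_pompeiuIdeal_iff {E : Set (G ⧸ K)} (hE : IsCompact E) {T : Set G}
    (hT : Subgroup.IsComplement T (K : Set G)) {s : C(G, ℂ)} :
    s ∈ zeroSet K (pompeiuIdeal dx K E T) ↔
      s ∈ sphericalFunctions K ∧ s ∈ vanishingIntegrals dx K (isCompact_lift hE) := by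
  have hA := isCompact_lift hE
  refine and_congr_right fun hs => ⟨fun h => ⟨hs.1, fun g => ?_⟩, fun h μ hμ => ?_⟩
  · -- Write `g⁻¹ = t k`; left invariance of `s` under `K` removes the factor `k`.
    obtain ⟨⟨t, k⟩, htk⟩ := hT.2 g⁻¹
    have hg : g = (k : G)⁻¹ * (t : G)⁻¹ := by
      rw [← mul_inv_rev, ← inv_eq_iff_eq_inv]
      exact htk.symm
    have h1 : conv (reflectedIndicator dx (lift K E)) (cosetMeasure K (t : G))
        ∈ pompeiuIdeal dx K E T := by
      refine Submodule.mem_sInf.2 fun J hJ => hJ.2 ⟨t, t.2, rfl⟩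
    have h2 := h _ h1
    rw [transform_generator dx hA _ hs.1] at h2
    rw [hg, mul_smul, setIntegral_smul_set dx (hA.smul _), ← h2]
    congr 1 with x
    simpa using hs.1 _ (K.inv_mem k.2) 1 K.one_mem x
  · obtain ⟨J, hJ, hmem⟩ := exists_isIdeal_transform_eq_zero hs
    refine ((hmem μ).1 (Submodule.mem_sInf.1 hμ J ⟨hJ, ?_⟩)).2
    rintro _ ⟨g, _, rfl⟩
    refine (hmem _).2 ⟨conv_reflectedIndicator_cosetMeasure_mem dx hA
      (fun x k hk => lift_mul_mem_iff x hk) g, ?_⟩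
    rw [transform_generator dx hA g hs.1, h.2]

end ZeroSet

end Pompeiu

theorem mainTheorem1 {G : Type*} [TopologicalSpace G] [Group G] [IsTopologicalGroup G]
    [LocallyCompactSpace G] [T2Space G] [SecondCountableTopology G]
    [MeasurableSpace G] [BorelSpace G]
    (dx : Measure G) [dx.IsHaarMeasure] [dx.IsMulRightInvariant]
    (K : Subgroup G) [CompactSpace K]
    (hGelfand : Pompeiu.IsGelfandPair K)
    (hSpectral : Pompeiu.SpectralAnalysis K)
    (E : Set (G ⧸ K)) (hE : IsCompact E)
    (T : Set G) (hT : Subgroup.IsComplement T (K : Set G)) :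
    Pompeiu.HasPompeiuProperty dx K E ↔
      Pompeiu.zeroSet K (Pompeiu.pompeiuIdeal dx K E T) = ∅ := by
  have hmem := fun {s} => Pompeiu.mem_zeroSet_pompeiuIdeal_iff dx hE hT (s := s)
  refine ⟨fun hP => eq_empty_of_forall_notMem fun s hsZ => ?_, fun hZ f hf => ?_⟩
  · -- A spherical function in the zero set descends to a counterexample on `G ⧸ K`.
    obtain ⟨hs, hsV⟩ := hmem.1 hsZ
    have hinv : ∀ a b : G, (QuotientGroup.leftRel K) a b → s a = s b := fun a b hab => by
      have := hs.1 1 K.one_mem _ (QuotientGroup.leftRel_apply.1 hab) a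
      simpa using this.symm
    let f : C(G ⧸ K, ℂ) := ⟨fun p => Quotient.lift s hinv p, s.continuous.quotient_lift hinv⟩
    have h0 : f = 0 := hP f fun g => by
      rw [Pompeiu.setIntegral_quotientMeasure dx hE]
      exact hsV.2 g
    have h1 : s 1 = 0 := DFunLike.congr_fun h0 ((1 : G) : G ⧸ K)
    exact one_ne_zero (hs.2.1.symm.trans h1)
  · ext p
    obtain ⟨a, rfl⟩ := QuotientGroup.mk_surjective p
    by_contra ha
    obtain ⟨F, hF, hF1⟩ := Pompeiu.exists_mem_vanishingIntegrals dx hE f hf a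
    have hV := Pompeiu.isVariety_vanishingIntegrals dx hGelfand (Pompeiu.isCompact_lift hE)
    obtain ⟨s, hsV, hs⟩ := hSpectral _ hV hV.le_biinv fun hbot => by
      rw [hbot, Submodule.mem_bot] at hF
      rw [hF] at hF1
      exact ha hF1.symm
    exact (hZ ▸ hmem.2 ⟨hs, hsV⟩ : s ∈ (∅ : Set C(G, ℂ)))
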